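/- Let $\mathcal P$ be the cone of real symmetric positive definite $n\times n$ matrices and let $\mu$ be a probability distribution on $\mathcal P$. Let $V\sim\mu$ and $Z\sim N(0,I_n)$ be independent. Then the random vector $X=V^{1/2}Z$ of $\mathbb R^n$ has a density $f$ with respect to Lebesgue measure, and: 1. $f\in L^2(\mathbb R^n)$ if and only if $$\mathbb E\left(\frac1{\det\sqrt{V+V_1}}\right)<\infty,$$ where $V$ and $V_1$ are independent with the same distribution $\mu$. 2. Suppose $f\in L^2(\mathbb R^n)$, and for $t\in\mathcal P$ let $$I(t)=\int_{\mathbb R^n}\left[f(x)-\frac1{\sqrt{(2\pi)^n\det t}}\,e^{-\frac12 x^*t^{-1}x}\right]^2dx ,$$ where $x^*$ is the transpose of $x$ (the integrand is integrable for every $t\in\mathcal P$). Then $I$ attains its minimum over $\mathcal P$ at some $t_0\in\mathcal P$, and every such minimizer $t=t_0$ is a solution of $$\int_{\mathcal P}\frac{(v+t)^{-1}}{\sqrt{\det(v+t)}}\,\mu(dv)=\frac1{2^{1+n/2}}\,\frac{t^{-1}}{\sqrt{\det t}},$$ where the matrix-valued integral is taken entrywise and every entry is $\mu$-integrable. -/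

import Mathlib

open MeasureTheory ProbabilityTheory Matrix
open scoped MatrixOrder ENNReal

noncomputable section

/-- Matrices carry the product σ-algebra, which is the Borel one. -/
instance matrixMeasurableSpace {n : ℕ} : MeasurableSpace (Matrix (Fin n) (Fin n) ℝ) :=
  inferInstanceAs (MeasurableSpace (Fin n → Fin n → ℝ))

instance matrixBorelSpace {n : ℕ} : BorelSpace (Matrix (Fin n) (Fin n) ℝ) :=
  inferInstanceAs (BorelSpace (Fin n → Fin n → ℝ))

/-- The cone of real (symmetric) positive definite matrices of order `n`. -/
def posDefCone (n : ℕ) : Set (Matrix (Fin n) (Fin n) ℝ) := {v | v.PosDef}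

/-- The random vector `V^{1/2} Z`, where `V^{1/2}` is the positive semidefinite square root
of the random matrix `V` and `Z` is a random vector of `ℝⁿ`. -/
def scaleMixture {n : ℕ} {Ω : Type*} (V : Ω → Matrix (Fin n) (Fin n) ℝ)
    (Z : Ω → EuclideanSpace ℝ (Fin n)) : Ω → EuclideanSpace ℝ (Fin n) :=
  fun ω => Matrix.toEuclideanCLM (𝕜 := ℝ) (CFC.sqrt (V ω)) (Z ω)

/-- `f` is (a version of) the density of the random vector `X` with respect to Lebesgue measure. -/
structure IsDensity {n : ℕ} {Ω : Type*} [MeasurableSpace Ω] (P : Measure Ω)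
    (X : Ω → EuclideanSpace ℝ (Fin n)) (f : EuclideanSpace ℝ (Fin n) → ℝ) : Prop where
  aemeasurable_var : AEMeasurable X P
  aemeasurable : AEMeasurable f volume
  nonneg : 0 ≤ᵐ[volume] f
  map_eq : P.map X = volume.withDensity (fun x => ENNReal.ofReal (f x))

/-- The density of `N(0, t)` on `ℝⁿ`. -/
def gaussianDensity {n : ℕ} (t : Matrix (Fin n) (Fin n) ℝ) (x : EuclideanSpace ℝ (Fin n)) : ℝ :=
  1 / √((2 * Real.pi) ^ n * t.det) * Real.exp (-(1 / 2) * (x.ofLp ⬝ᵥ t⁻¹ *ᵥ x.ofLp))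

/-- The squared `L²` distance between `f` and the density of `N(0, t)`. -/
def sqL2Dist {n : ℕ} (f : EuclideanSpace ℝ (Fin n) → ℝ) (t : Matrix (Fin n) (Fin n) ℝ) : ℝ :=
  ∫ x, (f x - gaussianDensity t x) ^ 2

/-- The matrix-valued function `v ↦ (v + t)⁻¹ / √det (v + t)`. -/
def resolventKernel {n : ℕ} (t v : Matrix (Fin n) (Fin n) ℝ) : Matrix (Fin n) (Fin n) ℝ :=
  (1 / √(v + t).det) • (v + t)⁻¹

end

/-! ### Determinant, trace and inverse inequalities on the positive definite cone. -/

section LinearAlgebra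

variable {n : ℕ} {v t p q : Matrix (Fin n) (Fin n) ℝ}

/-! Given `V = v`, the vector `X` is `N(0, v)`, so `f` is a mixture of centered Gaussian densities.
Everything rests on ∫ g_v g_t = (2π)^(-n/2) det(v+t)^(-1/2) (`lintegral_gaussianDensity_mul`). With
Tonelli it gives ‖f‖² = (2π)^(-n/2) E det(V+V₁)^(-1/2), which is part 1, and I(t) = ‖f‖² +
(2π)^(-n/2) J(t), where J(t) = det(2t)^(-1/2) - 2 E det(V+t)^(-1/2) is `distFunctional`.

A minimizer exists because J is negative somewhere (`exists_distFunctional_neg`) and its relevant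
sublevel set lies in a compact part of the cone: J ≤ 0 keeps det t away from 0, which is where ‖f‖ <
∞ enters, and then a large trace would drive E det(V+t)^(-1/2) to 0.

At a minimizer, J is differentiated along the rank one lines t + s xx*. The matrix determinant lemma
makes this a scalar computation, and the resulting identities of quadratic forms, for all x, are the
matrix equation. -/

lemma Matrix.PosSemidef.abs_apply_le_trace (hp : p.PosSemidef) (i j : Fin n) :
    |p i j| ≤ p.trace := by
  have hd : ∀ k, 0 ≤ p k k := fun k => hp.diag_nonneg
  have hs : p j i = p i j := by simpa using hp.1.apply i j
  have key : ∀ s : ℝ, 0 ≤ p i i + 2 * s * p i j + s ^ 2 * p j j := by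
    intro s
    have := hp.dotProduct_mulVec_nonneg (Pi.single i 1 + s • Pi.single j 1)
    simp [mulVec_add, mulVec_smul, dotProduct_add, add_dotProduct, hs] at this
    linarith
  have htr : ∀ k, p k k ≤ p.trace := fun k =>
    Finset.single_le_sum (f := fun k => p k k) (fun k _ => hd k) (Finset.mem_univ k)
  -- The values s = 1 and s = -1 give 2|p i j| ≤ p i i + p j j.
  have h1 := key 1
  have h2 := key (-1)
  have := htr i
  have := htr j
  rw [abs_le]
  constructor <;> linarith

/-- A crude entrywise estimate; any constant depending only on `n` serves below. -/
lemma Matrix.PosSemidef.trace_mul_le (hp : p.PosSemidef) (hq : q.PosSemidef) :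
    (p * q).trace ≤ n ^ 2 * (p.trace * q.trace) := by
  have : (p * q).trace = ∑ i, ∑ j, p i j * q j i := by
    simp [Matrix.trace, Matrix.mul_apply]
  rw [this]
  calc ∑ i, ∑ j, p i j * q j i ≤ ∑ _i : Fin n, ∑ _j : Fin n, p.trace * q.trace := by
        refine Finset.sum_le_sum fun i _ => Finset.sum_le_sum fun j _ => ?_
        refine (le_abs_self _).trans ?_
        rw [abs_mul]
        exact mul_le_mul (hp.abs_apply_le_trace i j) (hq.abs_apply_le_trace j i) (abs_nonneg _)
          hp.trace_nonneg
    _ = n ^ 2 * (p.trace * q.trace) := by simp; ring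

lemma Finset.one_add_sum_le_prod_one_add {ι : Type*} (s : Finset ι) (f : ι → ℝ)
    (hf : ∀ i, 0 ≤ f i) : 1 + ∑ i ∈ s, f i ≤ ∏ i ∈ s, (1 + f i) := by
  classical
  induction s using Finset.induction_on with
  | empty => simp
  | insert a s ha ih =>
    rw [Finset.sum_insert ha, Finset.prod_insert ha]
    have h0 : 0 ≤ ∑ i ∈ s, f i := Finset.sum_nonneg fun i _ => hf i
    nlinarith [hf a, mul_nonneg (hf a) h0]

lemma Matrix.PosSemidef.one_add_trace_le_det (hp : p.PosSemidef) :
    1 + p.trace ≤ (1 + p).det := by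
  have hU := hp.1.spectral_theorem
  set d := hp.1.eigenvalues
  have hdet : (1 + p).det = ∏ i, (1 + d i) := by
    have h1 : (1 + p) = Unitary.conjStarAlgAut ℝ _ hp.1.eigenvectorUnitary
        (diagonal (fun i => 1 + d i)) := by
      have : diagonal (fun i => 1 + d i) = 1 + diagonal (RCLike.ofReal ∘ d : Fin n → ℝ) := by
        ext i j; by_cases h : i = j <;> simp [h, diagonal]
      rw [this, map_add, map_one, ← hU]
    rw [h1, Unitary.conjStarAlgAut_apply, det_mul, det_mul, mul_right_comm, ← det_mul]
    simp
  have htr : p.trace = ∑ i, d i := by simpa using hp.1.trace_eq_sum_eigenvalues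
  rw [hdet, htr]
  exact Finset.one_add_sum_le_prod_one_add _ _ fun i => hp.eigenvalues_nonneg i

lemma Matrix.PosDef.exists_sqrt (ht : t.PosDef) :
    ∃ a : Matrix (Fin n) (Fin n) ℝ, a.PosDef ∧ a * a = t :=
  ⟨CFC.sqrt t, by
    have h0 : (CFC.sqrt t).PosSemidef := (CFC.sqrt_nonneg t).posSemidef
    rw [h0.posDef_iff_det_ne_zero]
    intro h
    have := CFC.sqrt_mul_sqrt_self t ht.posSemidef.nonneg
    have h2 := ht.det_pos
    rw [← this, det_mul, h] at h2
    simp at h2, CFC.sqrt_mul_sqrt_self t ht.posSemidef.nonneg⟩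

/-- With a = √t, v + t = a (1 + a⁻¹va⁻¹) a, which reduces to t = 1. Used both to bound det (v + t)
below by det t and, with the roles exchanged, to make it grow with t. -/
lemma Matrix.PosDef.det_mul_one_add_trace_le (ht : t.PosDef) (hv : v.PosSemidef) :
    t.det * (1 + (t⁻¹ * v).trace) ≤ (v + t).det := by
  obtain ⟨a, ha, rfl⟩ := ht.exists_sqrt
  have hu : IsUnit a.det := ha.det_pos.ne'.isUnit
  have hb : (a⁻¹ * v * a⁻¹).PosSemidef := by
    have := hv.conjTranspose_mul_mul_same a⁻¹
    rwa [ha.inv.1.eq] at this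
  have h1 := hb.one_add_trace_le_det
  have h2 : v + a * a = a * (1 + a⁻¹ * v * a⁻¹) * a := by
    rw [mul_add, add_mul, mul_one, add_comm]
    congr 1
    rw [mul_assoc a⁻¹, mul_nonsing_inv_cancel_left _ _ hu, nonsing_inv_mul_cancel_right _ _ hu]
  have h3 : ((a * a)⁻¹ * v).trace = (a⁻¹ * v * a⁻¹).trace := by
    rw [Matrix.mul_inv_rev, mul_assoc, trace_mul_comm]
  rw [h2, h3, det_mul, det_mul, det_mul, mul_right_comm _ (det (1 + _))]
  exact mul_le_mul_of_nonneg_left h1 (mul_self_nonneg _)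

lemma Matrix.PosDef.trace_inv_mul_nonneg (ht : t.PosDef) (hv : v.PosSemidef) :
    0 ≤ (t⁻¹ * v).trace := by
  obtain ⟨a, ha, rfl⟩ := ht.exists_sqrt
  have hb : (a⁻¹ * v * a⁻¹).PosSemidef := by
    have := hv.conjTranspose_mul_mul_same a⁻¹
    rwa [ha.inv.1.eq] at this
  rw [Matrix.mul_inv_rev, mul_assoc, trace_mul_comm]
  exact hb.trace_nonneg

lemma Matrix.PosDef.det_le_det_add (ht : t.PosDef) (hv : v.PosSemidef) :
    t.det ≤ (v + t).det := by
  have := ht.det_mul_one_add_trace_le hv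
  have h0 := ht.trace_inv_mul_nonneg hv
  nlinarith [mul_nonneg ht.det_pos.le h0]

/-- Converts a large trace of t into a large trace of v⁻¹t, for v fixed. -/
lemma Matrix.PosDef.trace_le_trace_inv_mul (hv : v.PosDef) (ht : t.PosSemidef) :
    t.trace ≤ n ^ 2 * (v.trace * (v⁻¹ * t).trace) := by
  obtain ⟨a, ha, rfl⟩ := hv.exists_sqrt
  have hu : IsUnit a.det := ha.det_pos.ne'.isUnit
  have hb : (a⁻¹ * t * a⁻¹).PosSemidef := by
    have := ht.conjTranspose_mul_mul_same a⁻¹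
    rwa [ha.inv.1.eq] at this
  have h1 := hv.posSemidef.trace_mul_le hb
  have h2 : (a * a * (a⁻¹ * t * a⁻¹)).trace = t.trace := by
    rw [mul_assoc a a, mul_assoc a⁻¹, mul_nonsing_inv_cancel_left _ _ hu, trace_mul_comm,
      nonsing_inv_mul_cancel_right _ _ hu]
  have h3 : ((a * a)⁻¹ * t).trace = (a⁻¹ * t * a⁻¹).trace := by
    rw [Matrix.mul_inv_rev, mul_assoc, trace_mul_comm]
  rw [h3, ← h2]
  exact h1

/-- With y = (v+t)⁻¹x and z = t⁻¹x, the difference of the two sides is (z-y)*t(z-y) + y*vy ≥ 0. -/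
lemma Matrix.PosDef.dotProduct_inv_add_mulVec_le (ht : t.PosDef) (hv : v.PosSemidef)
    (x : Fin n → ℝ) : x ⬝ᵥ (v + t)⁻¹ *ᵥ x ≤ x ⬝ᵥ t⁻¹ *ᵥ x := by
  have hvt : (v + t).PosDef := PosDef.posSemidef_add hv ht
  set y := (v + t)⁻¹ *ᵥ x with hy
  set z := t⁻¹ *ᵥ x with hz
  have hy' : v *ᵥ y + t *ᵥ y = x := by
    rw [← add_mulVec, hy, mulVec_mulVec, mul_nonsing_inv _ hvt.det_pos.ne'.isUnit, one_mulVec]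
  have hz' : t *ᵥ z = x := by
    rw [hz, mulVec_mulVec, mul_nonsing_inv _ ht.det_pos.ne'.isUnit, one_mulVec]
  have h1 := ht.posSemidef.dotProduct_mulVec_nonneg (z - y)
  have h2 := hv.dotProduct_mulVec_nonneg y
  simp only [star_trivial, mulVec_sub, dotProduct_sub, sub_dotProduct, hz'] at h1 h2
  have h3 : z ⬝ᵥ t *ᵥ y = x ⬝ᵥ y := by
    rw [dotProduct_mulVec, ← mulVec_transpose, ← conjTranspose_eq_transpose_of_trivial, ht.1.eq,
      hz']
  have h4 : y ⬝ᵥ v *ᵥ y + y ⬝ᵥ t *ᵥ y = x ⬝ᵥ y := by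
    rw [← dotProduct_add, hy', dotProduct_comm]
  rw [h3, dotProduct_comm z x, dotProduct_comm y x] at h1
  linarith

lemma Matrix.PosDef.trace_inv_add_le (ht : t.PosDef) (hv : v.PosSemidef) :
    (v + t)⁻¹.trace ≤ t⁻¹.trace := by
  refine Finset.sum_le_sum fun i _ => ?_
  simpa using ht.dotProduct_inv_add_mulVec_le hv (Pi.single i 1)

/-- The matrix determinant lemma for a symmetric rank one perturbation. -/
lemma Matrix.det_add_smul_vecMulVec (ht : t.det ≠ 0) (s : ℝ) (x : Fin n → ℝ) :
    (t + s • vecMulVec x x).det = t.det * (1 + s * (x ⬝ᵥ t⁻¹ *ᵥ x)) := by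
  have h := det_add_replicateCol_mul_replicateRow (ι := Unit) ht.isUnit (s • x) x
  rw [← vecMulVec_eq, smul_vecMulVec] at h
  rw [h, det_eq_elem_of_subsingleton _ ()]
  congr 1
  rw [Matrix.add_apply, ← replicateRow_vecMul, replicateRow_mul_replicateCol_apply,
    ← dotProduct_mulVec, mulVec_smul, dotProduct_smul]
  simp

lemma Matrix.eq_of_dotProduct_mulVec_eq (hp : p.IsHermitian) (hq : q.IsHermitian)
    (h : ∀ x : Fin n → ℝ, x ⬝ᵥ p *ᵥ x = x ⬝ᵥ q *ᵥ x) : p = q := by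
  ext i j
  have hps : p j i = p i j := by simpa using hp.apply i j
  have hqs : q j i = q i j := by simpa using hq.apply i j
  have h1 := h (Pi.single i 1 + Pi.single j 1)
  have h2 := h (Pi.single i 1)
  have h3 := h (Pi.single j 1)
  simp [mulVec_add, add_dotProduct] at h1 h2 h3
  linarith

lemma Matrix.isClosed_setOf_posSemidef :
    IsClosed {t : Matrix (Fin n) (Fin n) ℝ | t.PosSemidef} := by
  simp only [posSemidef_iff_dotProduct_mulVec, IsHermitian, Set.ofPred_and, Set.ofPred_forall]
  refine (isClosed_eq (by fun_prop) continuous_id).inter (isClosed_iInter fun x => ?_)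
  exact isClosed_le continuous_const (by fun_prop)

/-- Positive definite matrices of determinant and trace bounded away from the boundary of the cone
form a compact set. -/
lemma Matrix.isCompact_posDef_le_det_trace_le {a R : ℝ} (ha : 0 < a) :
    IsCompact {t : Matrix (Fin n) (Fin n) ℝ | t.PosDef ∧ a ≤ t.det ∧ t.trace ≤ R} := by
  have hK : IsCompact (show Set (Matrix (Fin n) (Fin n) ℝ) from
      Set.pi Set.univ fun _ => Set.pi Set.univ fun _ => Set.Icc (-R) R) :=
    isCompact_univ_pi fun _ => isCompact_univ_pi fun _ => isCompact_Icc
  refine hK.of_isClosed_subset ?_ ?_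
  -- The floor on the determinant makes definiteness equivalent to semidefiniteness, a closed
  -- condition.
  · have : {t : Matrix (Fin n) (Fin n) ℝ | t.PosDef ∧ a ≤ t.det ∧ t.trace ≤ R} =
        {t | t.PosSemidef} ∩ ({t | a ≤ t.det} ∩ {t | t.trace ≤ R}) := by
      ext t
      simp only [Set.mem_ofPred_eq, Set.mem_inter_iff]
      constructor
      · exact fun h => ⟨h.1.posSemidef, h.2⟩
      · exact fun h => ⟨h.1.posDef_iff_det_ne_zero.2 (ha.trans_le h.2.1).ne', h.2⟩
    rw [this]
    exact isClosed_setOf_posSemidef.inter ((isClosed_le continuous_const (by fun_prop)).inter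
      (isClosed_le (by fun_prop) continuous_const))
  · intro t ht i _ j _
    exact abs_le.1 ((ht.1.posSemidef.abs_apply_le_trace i j).trans ht.2.2)

end LinearAlgebra

/-! ### Gaussian densities and the integral of a product of two of them. -/

section GaussianDensity

variable {n : ℕ} {v t : Matrix (Fin n) (Fin n) ℝ}

instance matrixSecondCountableTopology : SecondCountableTopology (Matrix (Fin n) (Fin n) ℝ) :=
  inferInstanceAs (SecondCountableTopology (Fin n → Fin n → ℝ))

lemma gaussianDensity_nonneg (t : Matrix (Fin n) (Fin n) ℝ) (x : EuclideanSpace ℝ (Fin n)) :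
    0 ≤ gaussianDensity t x := by
  unfold gaussianDensity
  positivity

lemma measurable_gaussianDensity_uncurry :
    Measurable fun z : Matrix (Fin n) (Fin n) ℝ × EuclideanSpace ℝ (Fin n) =>
      gaussianDensity z.1 z.2 := by
  have h1 : Measurable fun z : Matrix (Fin n) (Fin n) ℝ × EuclideanSpace ℝ (Fin n) =>
      z.1.det := (by fun_prop : Continuous _).measurable
  have h2 : Measurable fun z : Matrix (Fin n) (Fin n) ℝ × EuclideanSpace ℝ (Fin n) =>
      z.2.ofLp ⬝ᵥ z.1.adjugate *ᵥ z.2.ofLp :=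
    (by fun_prop : Continuous _).measurable
  -- The inverse becomes adjugate over determinant, measurable at singular matrices too.
  simp only [gaussianDensity, Matrix.inv_def, Ring.inverse_eq_inv', smul_mulVec, dotProduct_smul,
    smul_eq_mul]
  fun_prop

lemma measurable_gaussianDensity (t : Matrix (Fin n) (Fin n) ℝ) :
    Measurable (gaussianDensity t) :=
  measurable_gaussianDensity_uncurry.comp measurable_prodMk_left

lemma measurable_matrix_inv_apply (i j : Fin n) :
    Measurable fun v : Matrix (Fin n) (Fin n) ℝ => v⁻¹ i j := by
  have h1 : Measurable fun v : Matrix (Fin n) (Fin n) ℝ => v.det :=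
    (by fun_prop : Continuous _).measurable
  have h2 : Measurable fun v : Matrix (Fin n) (Fin n) ℝ => v.adjugate i j :=
    (by fun_prop : Continuous _).measurable
  simp only [Matrix.inv_def, Ring.inverse_eq_inv', Matrix.smul_apply, smul_eq_mul]
  fun_prop

/-- The indicator of a box is a product of indicators, so the integral over a box factors, and boxes
determine the product measure. -/
lemma pi_withDensity_ofReal {f : ℝ → ℝ} (hf : Integrable f) (h0 : ∀ x, 0 ≤ f x)
    [SigmaFinite (volume.withDensity fun x => ENNReal.ofReal (f x))] :
    Measure.pi (fun _ : Fin n => volume.withDensity fun x => ENNReal.ofReal (f x)) =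
      volume.withDensity fun x : Fin n → ℝ => ENNReal.ofReal (∏ i, f (x i)) := by
  refine (Measure.pi_eq fun s hs => ?_)
  have hi : ∀ i, Integrable ((s i).indicator f) := fun i => hf.indicator (hs i)
  have h0i : ∀ i, ∀ x, 0 ≤ (s i).indicator f x := fun i x => Set.indicator_nonneg (fun x _ => h0 x) x
  have hS : MeasurableSet (Set.univ.pi s) := MeasurableSet.univ_pi hs
  have hind : ∀ x : Fin n → ℝ, (Set.univ.pi s).indicator
      (fun x => ENNReal.ofReal (∏ i, f (x i))) x =
      ENNReal.ofReal (∏ i, (s i).indicator f (x i)) := by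
    intro x
    by_cases hx : x ∈ Set.univ.pi s
    · rw [Set.indicator_of_mem hx]
      congr 1
      exact Finset.prod_congr rfl fun i _ => (Set.indicator_of_mem (hx i (Set.mem_univ i)) _).symm
    · rw [Set.indicator_of_notMem hx]
      simp only [Set.mem_pi, Set.mem_univ, true_imp_iff, not_forall] at hx
      obtain ⟨i, hi⟩ := hx
      rw [Finset.prod_eq_zero (Finset.mem_univ i) (Set.indicator_of_notMem hi _)]
      simp
  rw [withDensity_apply _ hS, ← lintegral_indicator hS, lintegral_congr hind,
    ← ofReal_integral_eq_lintegral_ofReal (by exact Integrable.fintype_prod hi)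
      (Filter.Eventually.of_forall fun x => Finset.prod_nonneg fun i _ => h0i i _),
    integral_fintype_prod_volume_eq_prod (fun i => (s i).indicator f),
    ENNReal.ofReal_prod_of_nonneg fun i _ => integral_nonneg (h0i i)]
  refine Finset.prod_congr rfl fun i _ => ?_
  rw [withDensity_apply _ (hs i), ofReal_integral_eq_lintegral_ofReal (hi i)
    (Filter.Eventually.of_forall (h0i i)), ← lintegral_indicator (hs i)]
  congr 1 with x
  by_cases hx : x ∈ s i <;> simp [hx]

lemma gaussianDensity_one (x : EuclideanSpace ℝ (Fin n)) :
    gaussianDensity 1 x = ∏ i, gaussianPDFReal 0 1 (x i) := by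
  simp only [gaussianPDFReal, gaussianDensity, Finset.prod_mul_distrib, Finset.prod_const,
    Finset.card_univ, Fintype.card_fin, ← Real.exp_sum, det_one, inv_one, one_mulVec, dotProduct]
  congr 1
  · rw [mul_one, Real.sqrt_eq_rpow, Real.sqrt_eq_rpow, ← Real.rpow_natCast, ← Real.rpow_natCast,
      Real.inv_rpow (by positivity), ← Real.rpow_mul (by positivity),
      ← Real.rpow_mul (by positivity)]
    simp [mul_comm]
  · rw [Finset.mul_sum]
    congr 1
    refine Finset.sum_congr rfl fun i _ => ?_
    simp
    ring

lemma stdGaussian_eq_withDensity : stdGaussian (EuclideanSpace ℝ (Fin n)) =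
    volume.withDensity fun x => ENNReal.ofReal (gaussianDensity 1 x) := by
  have hg : gaussianReal 0 1 = volume.withDensity
      fun x => ENNReal.ofReal (gaussianPDFReal 0 1 x) := by
    rw [gaussianReal_of_var_ne_zero _ one_ne_zero]; rfl
  have : SigmaFinite (volume.withDensity fun x => ENNReal.ofReal (gaussianPDFReal 0 1 x)) := by
    rw [← hg]; infer_instance
  rw [← map_pi_eq_stdGaussian, hg, pi_withDensity_ofReal (integrable_gaussianPDFReal 0 1)
    (gaussianPDFReal_nonneg 0 1)]
  ext s hs
  have hm : Measurable (WithLp.toLp 2 : (Fin n → ℝ) → EuclideanSpace ℝ (Fin n)) := by fun_prop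
  rw [Measure.map_apply hm hs, withDensity_apply _ (hm hs), withDensity_apply _ hs,
    ← (PiLp.volume_preserving_toLp (Fin n)).map_eq, setLIntegral_map hs
      (measurable_gaussianDensity 1).ennreal_ofReal hm]
  simp only [gaussianDensity_one]

/-- For a = √t, (ax)*t⁻¹(ax) = x*x, and √(det t) = det a is the Jacobian. -/
lemma gaussianDensity_sqrt_mulVec (ht : t.PosDef) (x : EuclideanSpace ℝ (Fin n)) :
    gaussianDensity 1 x = (CFC.sqrt t).det *
      gaussianDensity t (Matrix.toEuclideanCLM (𝕜 := ℝ) (CFC.sqrt t) x) := by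
  have hs := CFC.sqrt_mul_sqrt_self t ht.posSemidef.nonneg
  have hp : (CFC.sqrt t).PosSemidef := (CFC.sqrt_nonneg t).posSemidef
  set a := CFC.sqrt t
  have hd : t.det = a.det ^ 2 := by rw [← hs, det_mul, sq]
  have h0 : a.det ≠ 0 := fun h => ht.det_pos.ne' (by simp [hd, h])
  have hat : aᵀ = a := by rw [← conjTranspose_eq_transpose_of_trivial, hp.1.eq]
  have hq : (a *ᵥ x.ofLp) ⬝ᵥ t⁻¹ *ᵥ (a *ᵥ x.ofLp) = x.ofLp ⬝ᵥ x.ofLp := by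
    rw [dotProduct_comm, dotProduct_mulVec, ← mulVec_transpose, hat, mulVec_mulVec, mulVec_mulVec,
      ← hs, Matrix.mul_inv_rev, mul_assoc a, mul_assoc a⁻¹, nonsing_inv_mul _ h0.isUnit, mul_one,
      mul_nonsing_inv _ h0.isUnit, one_mulVec]
  have hpos : 0 < a.det := hp.det_nonneg.lt_of_ne' h0
  simp only [gaussianDensity, ofLp_toEuclideanCLM, hq, hd, det_one, inv_one, one_mulVec]
  rw [Real.sqrt_mul (by positivity) (a.det ^ 2), Real.sqrt_sq hpos.le, mul_one]
  field_simp

lemma map_sqrt_stdGaussian (ht : t.PosDef) :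
    (stdGaussian (EuclideanSpace ℝ (Fin n))).map (Matrix.toEuclideanCLM (𝕜 := ℝ) (CFC.sqrt t)) =
      volume.withDensity fun x => ENNReal.ofReal (gaussianDensity t x) := by
  have hp : (CFC.sqrt t).PosSemidef := (CFC.sqrt_nonneg t).posSemidef
  have h0 : 0 < (CFC.sqrt t).det := by
    rw [ht.posSemidef.det_sqrt]
    simpa using ht.det_pos
  have hdet : LinearMap.det (Matrix.toEuclideanCLM (𝕜 := ℝ) (CFC.sqrt t) :
      EuclideanSpace ℝ (Fin n) →ₗ[ℝ] EuclideanSpace ℝ (Fin n)) = (CFC.sqrt t).det := by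
    rw [coe_toEuclideanCLM_eq_toEuclideanLin]
    simp [toLpLin_eq_toLin]
  have hm : Measurable (Matrix.toEuclideanCLM (𝕜 := ℝ) (CFC.sqrt t)) :=
    (Matrix.toEuclideanCLM (𝕜 := ℝ) (CFC.sqrt t)).continuous.measurable
  have hmap := Measure.map_linearMap_addHaar_eq_smul_addHaar
    (volume : Measure (EuclideanSpace ℝ (Fin n))) (f := (Matrix.toEuclideanCLM (𝕜 := ℝ)
      (CFC.sqrt t) : EuclideanSpace ℝ (Fin n) →ₗ[ℝ] EuclideanSpace ℝ (Fin n)))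
      (by rw [hdet]; exact h0.ne')
  rw [hdet, ContinuousLinearMap.coe_coe] at hmap
  have hg := (measurable_gaussianDensity t).ennreal_ofReal
  rw [stdGaussian_eq_withDensity]
  ext s hs
  rw [Measure.map_apply hm hs, withDensity_apply _ (hm hs), withDensity_apply _ hs]
  simp only [gaussianDensity_sqrt_mulVec ht, ENNReal.ofReal_mul h0.le]
  rw [lintegral_const_mul _ (by exact hg.comp hm), ← setLIntegral_map hs hg hm, hmap,
    Measure.restrict_smul, lintegral_smul_measure, smul_eq_mul, ← mul_assoc,
    ← ENNReal.ofReal_mul h0.le, abs_of_pos (inv_pos.2 h0), mul_inv_cancel₀ h0.ne']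
  simp

lemma lintegral_gaussianDensity (ht : t.PosDef) :
    ∫⁻ x, ENNReal.ofReal (gaussianDensity t x) = 1 := by
  have h : (stdGaussian (EuclideanSpace ℝ (Fin n))).map
      (Matrix.toEuclideanCLM (𝕜 := ℝ) (CFC.sqrt t)) Set.univ = 1 := by
    rw [Measure.map_apply (ContinuousLinearMap.continuous _).measurable MeasurableSet.univ]
    simp
  rwa [map_sqrt_stdGaussian ht, withDensity_apply _ MeasurableSet.univ,
    Measure.restrict_univ] at h

/-- The exponents add up to the form of v⁻¹ + t⁻¹ = v⁻¹(v+t)t⁻¹, whose determinant fixes the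
constant. Integrating the product then only needs the total mass of a Gaussian. -/
lemma gaussianDensity_mul_gaussianDensity (hv : v.PosDef) (ht : t.PosDef)
    (x : EuclideanSpace ℝ (Fin n)) :
    gaussianDensity v x * gaussianDensity t x =
      1 / √((2 * Real.pi) ^ n * (v + t).det) * gaussianDensity (v⁻¹ + t⁻¹)⁻¹ x := by
  have hu : (v⁻¹ + t⁻¹).PosDef := hv.inv.add ht.inv
  have hvt : (v + t).PosDef := hv.add ht
  have h1 : v⁻¹ + t⁻¹ = v⁻¹ * (v + t) * t⁻¹ := by
    rw [mul_add, add_mul, nonsing_inv_mul _ hv.det_pos.ne'.isUnit, one_mul, mul_assoc,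
      mul_nonsing_inv _ ht.det_pos.ne'.isUnit, mul_one, add_comm]
  have hd : (v⁻¹ + t⁻¹)⁻¹.det = v.det * t.det / (v + t).det := by
    rw [det_nonsing_inv, Ring.inverse_eq_inv', h1, det_mul, det_mul, det_nonsing_inv,
      det_nonsing_inv, Ring.inverse_eq_inv']
    have := hv.det_pos
    have := ht.det_pos
    have := hvt.det_pos
    field_simp
  have h2 : x.ofLp ⬝ᵥ (v⁻¹ + t⁻¹)⁻¹⁻¹ *ᵥ x.ofLp =
      x.ofLp ⬝ᵥ v⁻¹ *ᵥ x.ofLp + x.ofLp ⬝ᵥ t⁻¹ *ᵥ x.ofLp := by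
    rw [nonsing_inv_nonsing_inv _ hu.det_pos.ne'.isUnit, add_mulVec, dotProduct_add]
  have h3 : √((2 * Real.pi) ^ n * v.det) * √((2 * Real.pi) ^ n * t.det) =
      √((2 * Real.pi) ^ n * (v + t).det) *
        √((2 * Real.pi) ^ n * (v⁻¹ + t⁻¹)⁻¹.det) := by
    have := hv.det_pos
    have := ht.det_pos
    have := hvt.det_pos
    rw [← Real.sqrt_mul (by positivity), ← Real.sqrt_mul (by positivity), hd]
    congr 1
    field_simp
  simp only [gaussianDensity]
  rw [mul_mul_mul_comm, ← Real.exp_add, ← mul_assoc, div_mul_div_comm, div_mul_div_comm, h3, h2,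
    ← mul_add]

lemma lintegral_gaussianDensity_mul (hv : v.PosDef) (ht : t.PosDef) :
    ∫⁻ x, ENNReal.ofReal (gaussianDensity v x) * ENNReal.ofReal (gaussianDensity t x) =
      ENNReal.ofReal (1 / √((2 * Real.pi) ^ n * (v + t).det)) := by
  simp only [← ENNReal.ofReal_mul (gaussianDensity_nonneg v _),
    gaussianDensity_mul_gaussianDensity hv ht]
  simp only [ENNReal.ofReal_mul (show 0 ≤ 1 / √((2 * Real.pi) ^ n * (v + t).det) by positivity)]
  rw [lintegral_const_mul _ (measurable_gaussianDensity _).ennreal_ofReal,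
    lintegral_gaussianDensity (hv.inv.add ht.inv).inv, mul_one]

end GaussianDensity

/-! ### The mixture density and the criterion for square integrability. -/

section Mixture

variable {n : ℕ} {μ : Measure (Matrix (Fin n) (Fin n) ℝ)} {t : Matrix (Fin n) (Fin n) ℝ}

open scoped Matrix.Norms.L2Operator in
lemma Matrix.continuousOn_sqrt_posSemidef :
    ContinuousOn (CFC.sqrt : Matrix (Fin n) (Fin n) ℝ → _) {v | v.PosSemidef} := by
  simp only [← Matrix.nonneg_iff_posSemidef]
  exact CFC.continuousOn_sqrt

lemma Matrix.measurable_sqrt :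
    Measurable (CFC.sqrt : Matrix (Fin n) (Fin n) ℝ → Matrix (Fin n) (Fin n) ℝ) := by
  classical
  have h : (CFC.sqrt : Matrix (Fin n) (Fin n) ℝ → Matrix (Fin n) (Fin n) ℝ) =
      {v | v.PosSemidef}.piecewise CFC.sqrt (fun _ => 0) := by
    ext1 v
    by_cases hv : v.PosSemidef
    · rw [Set.piecewise_eq_of_mem {v : Matrix (Fin n) (Fin n) ℝ | v.PosSemidef} _ _ hv]
    · rw [Set.piecewise_eq_of_notMem {v : Matrix (Fin n) (Fin n) ℝ | v.PosSemidef} _ _ hv]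
      -- Outside the closed semidefinite cone `CFC.sqrt` takes the default value 0.
      exact cfcₙ_apply_of_not_predicate v fun h => hv h.posSemidef
  rw [h]
  exact continuousOn_sqrt_posSemidef.measurable_piecewise continuousOn_const
    isClosed_setOf_posSemidef.measurableSet

lemma measurable_sqrt_apply :
    Measurable fun z : Matrix (Fin n) (Fin n) ℝ × EuclideanSpace ℝ (Fin n) =>
      Matrix.toEuclideanCLM (𝕜 := ℝ) (CFC.sqrt z.1) z.2 := by
  have h1 : Measurable fun z : Matrix (Fin n) (Fin n) ℝ × EuclideanSpace ℝ (Fin n) =>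
      WithLp.toLp 2 (z.1 *ᵥ z.2.ofLp) := (by fun_prop : Continuous _).measurable
  exact h1.comp ((measurable_sqrt.comp measurable_fst).prodMk measurable_snd)

/-- The mixture of the centered Gaussian densities with covariance distributed as `μ`. -/
noncomputable def mixtureDensity (μ : Measure (Matrix (Fin n) (Fin n) ℝ))
    (x : EuclideanSpace ℝ (Fin n)) : ℝ≥0∞ :=
  ∫⁻ v, ENNReal.ofReal (gaussianDensity v x) ∂μ

lemma measurable_mixtureDensity [SFinite μ] : Measurable (mixtureDensity μ) :=
  measurable_gaussianDensity_uncurry.ennreal_ofReal.lintegral_prod_left'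

/-- Tonelli with `h` left free: a Gaussian density, the mixture itself and 1 yield the cross term,
the squared norm and the total mass. -/
lemma lintegral_mixtureDensity_mul [SFinite μ] {h : EuclideanSpace ℝ (Fin n) → ℝ≥0∞}
    (hh : Measurable h) : ∫⁻ x, mixtureDensity μ x * h x =
      ∫⁻ v, (∫⁻ x, ENNReal.ofReal (gaussianDensity v x) * h x) ∂μ := by
  have hm := measurable_gaussianDensity_uncurry (n := n).ennreal_ofReal
  rw [lintegral_lintegral_swap (hm.mul (hh.comp measurable_snd)).aemeasurable]
  refine lintegral_congr fun x => ?_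
  exact (lintegral_mul_const _ (hm.comp measurable_prodMk_right)).symm

lemma lintegral_mixtureDensity_mul_gaussianDensity [SFinite μ] (hμ : ∀ᵐ v ∂μ, v.PosDef)
    (ht : t.PosDef) : ∫⁻ x, mixtureDensity μ x * ENNReal.ofReal (gaussianDensity t x) =
      ∫⁻ v, ENNReal.ofReal (1 / √((2 * Real.pi) ^ n * (v + t).det)) ∂μ := by
  rw [lintegral_mixtureDensity_mul (measurable_gaussianDensity t).ennreal_ofReal]
  refine lintegral_congr_ae ?_
  filter_upwards [hμ] with v hv
  exact lintegral_gaussianDensity_mul hv ht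

lemma lintegral_mixtureDensity_sq [SFinite μ] (hμ : ∀ᵐ v ∂μ, v.PosDef) :
    ∫⁻ x, mixtureDensity μ x * mixtureDensity μ x =
      ∫⁻ v, ∫⁻ w, ENNReal.ofReal (1 / √((2 * Real.pi) ^ n * (w + v).det)) ∂μ ∂μ := by
  rw [lintegral_mixtureDensity_mul measurable_mixtureDensity]
  refine lintegral_congr_ae ?_
  filter_upwards [hμ] with v hv
  simp only [mul_comm _ (mixtureDensity μ _)]
  exact lintegral_mixtureDensity_mul_gaussianDensity hμ hv

lemma lintegral_mixtureDensity [IsProbabilityMeasure μ] (hμ : ∀ᵐ v ∂μ, v.PosDef) :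
    ∫⁻ x, mixtureDensity μ x = 1 := by
  have h := lintegral_mixtureDensity_mul (μ := μ) (h := fun _ => 1) measurable_const
  simp only [mul_one] at h
  rw [h, lintegral_congr_ae (g := fun _ => 1)]
  · simp
  · filter_upwards [hμ] with v hv
    exact lintegral_gaussianDensity hv

variable {Ω : Type*} [MeasurableSpace Ω] {P : Measure Ω}
  {V : Ω → Matrix (Fin n) (Fin n) ℝ} {Z : Ω → EuclideanSpace ℝ (Fin n)}

lemma aemeasurable_sqrt_apply_comp (h : AEMeasurable (fun ω => (V ω, Z ω)) P) :
    AEMeasurable ((fun z : Matrix (Fin n) (Fin n) ℝ × EuclideanSpace ℝ (Fin n) =>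
      Matrix.toEuclideanCLM (𝕜 := ℝ) (CFC.sqrt z.1) z.2) ∘ fun ω => (V ω, Z ω)) P :=
  measurable_sqrt_apply.comp_aemeasurable h

lemma aemeasurable_scaleMixture (hV : AEMeasurable V P) (hZ : AEMeasurable Z P) :
    AEMeasurable (scaleMixture V Z) P :=
  aemeasurable_sqrt_apply_comp (hV.prodMk hZ)

/-- By independence the joint law is a product; its section at v is the image of the standard
Gaussian under √v, that is `N(0, v)`. -/
lemma map_scaleMixture [IsProbabilityMeasure P] [IsProbabilityMeasure μ]
    (hμ : ∀ᵐ v ∂μ, v.PosDef) (hV : HasLaw V μ P)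
    (hZ : HasLaw Z (stdGaussian (EuclideanSpace ℝ (Fin n))) P) (hVZ : IndepFun V Z P) :
    P.map (scaleMixture V Z) = volume.withDensity (mixtureDensity μ) := by
  have hL := hVZ.hasLaw_prod hV hZ
  have hm := measurable_gaussianDensity_uncurry (n := n).ennreal_ofReal
  ext s hs
  have h1 : P.map (scaleMixture V Z) = (μ.prod (stdGaussian (EuclideanSpace ℝ (Fin n)))).map
      fun z => Matrix.toEuclideanCLM (𝕜 := ℝ) (CFC.sqrt z.1) z.2 := by
    rw [← hL.map_eq, AEMeasurable.map_map_of_aemeasurable measurable_sqrt_apply.aemeasurable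
      hL.aemeasurable]
    rfl
  rw [h1, Measure.map_apply measurable_sqrt_apply hs,
    Measure.prod_apply (measurable_sqrt_apply hs), withDensity_apply _ hs]
  simp only [mixtureDensity]
  rw [← lintegral_lintegral_swap hm.aemeasurable]
  refine lintegral_congr_ae ?_
  filter_upwards [hμ] with v hv
  have h2 := congrArg (fun ν => ν s) (map_sqrt_stdGaussian hv)
  rwa [Measure.map_apply (ContinuousLinearMap.continuous _).measurable hs,
    withDensity_apply _ hs] at h2

lemma isDensity_mixtureDensity [IsProbabilityMeasure P] [IsProbabilityMeasure μ]
    (hμ : ∀ᵐ v ∂μ, v.PosDef) (hV : HasLaw V μ P)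
    (hZ : HasLaw Z (stdGaussian (EuclideanSpace ℝ (Fin n))) P) (hVZ : IndepFun V Z P) :
    IsDensity P (scaleMixture V Z) fun x => (mixtureDensity μ x).toReal where
  aemeasurable_var := aemeasurable_scaleMixture hV.aemeasurable hZ.aemeasurable
  aemeasurable := measurable_mixtureDensity.ennreal_toReal.aemeasurable
  nonneg := Filter.Eventually.of_forall fun _ => ENNReal.toReal_nonneg
  map_eq := by
    rw [map_scaleMixture hμ hV hZ hVZ]
    refine withDensity_congr_ae ?_
    -- Total mass 1 makes the mixture finite almost everywhere, so `toReal` loses nothing.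
    have := ae_lt_top (measurable_mixtureDensity (μ := μ))
      (by rw [lintegral_mixtureDensity hμ]; exact ENNReal.one_ne_top)
    filter_upwards [this] with x hx
    rw [ENNReal.ofReal_toReal hx.ne]

/-- Uniqueness of densities lets every version of f be replaced by the mixture. -/
lemma IsDensity.ofReal_ae_eq [IsProbabilityMeasure P] [IsProbabilityMeasure μ]
    (hμ : ∀ᵐ v ∂μ, v.PosDef) (hV : HasLaw V μ P)
    (hZ : HasLaw Z (stdGaussian (EuclideanSpace ℝ (Fin n))) P) (hVZ : IndepFun V Z P)
    {f : EuclideanSpace ℝ (Fin n) → ℝ} (hf : IsDensity P (scaleMixture V Z) f) :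
    (fun x => ENNReal.ofReal (f x)) =ᵐ[volume] mixtureDensity μ := by
  rw [← withDensity_eq_iff_of_sigmaFinite hf.aemeasurable.ennreal_ofReal
    measurable_mixtureDensity.aemeasurable, ← hf.map_eq, map_scaleMixture hμ hV hZ hVZ]

lemma one_div_sqrt_two_pi_pow_mul (d : ℝ) :
    1 / √((2 * Real.pi) ^ n * d) = 1 / √((2 * Real.pi) ^ n) * (1 / √d) := by
  rw [Real.sqrt_mul (by positivity), div_mul_div_comm, mul_one]

lemma measurable_ofReal_one_div_sqrt_det_add :
    Measurable fun z : Matrix (Fin n) (Fin n) ℝ × Matrix (Fin n) (Fin n) ℝ =>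
      ENNReal.ofReal (1 / √(z.1 + z.2).det) := by
  have : Measurable fun z : Matrix (Fin n) (Fin n) ℝ × Matrix (Fin n) (Fin n) ℝ =>
      (z.1 + z.2).det := (by fun_prop : Continuous _).measurable
  fun_prop

lemma memLp_two_iff_lintegral_lt_top [IsProbabilityMeasure P] [IsProbabilityMeasure μ]
    (hμ : ∀ᵐ v ∂μ, v.PosDef)
    {f : EuclideanSpace ℝ (Fin n) → ℝ} (hfm : AEMeasurable f) (hf0 : 0 ≤ᵐ[volume] f)
    (hf : (fun x => ENNReal.ofReal (f x)) =ᵐ[volume] mixtureDensity μ)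
    {U U₁ : Ω → Matrix (Fin n) (Fin n) ℝ} (hU : HasLaw U μ P) (hU₁ : HasLaw U₁ μ P)
    (hUU : IndepFun U U₁ P) :
    MemLp f 2 volume ↔
      ∫⁻ ω, ENNReal.ofReal (1 / (CFC.sqrt (U ω + U₁ ω)).det) ∂P < ∞ := by
  have hL := hUU.hasLaw_prod hU hU₁
  have hmeas := measurable_ofReal_one_div_sqrt_det_add (n := n)
  have h1 : ∫⁻ ω, ENNReal.ofReal (1 / (CFC.sqrt (U ω + U₁ ω)).det) ∂P =
      ∫⁻ v, ∫⁻ w, ENNReal.ofReal (1 / √(w + v).det) ∂μ ∂μ := by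
    rw [← lintegral_prod_symm' _ hmeas, ← hL.lintegral_comp hmeas.aemeasurable]
    refine lintegral_congr_ae ?_
    have hm1 := ae_of_ae_map hU.aemeasurable (by rwa [hU.map_eq])
    have hm2 := ae_of_ae_map hU₁.aemeasurable (by rwa [hU₁.map_eq])
    filter_upwards [hm1, hm2] with ω h1 h2
    rw [(h1.add h2).posSemidef.det_sqrt]
    simp [RCLike.sqrt_of_nonneg (h1.add h2).det_pos.le]
  have h2 : ∫⁻ x, ‖f x‖ₑ ^ (2 : ℝ) = ENNReal.ofReal (1 / √((2 * Real.pi) ^ n)) *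
      ∫⁻ v, ∫⁻ w, ENNReal.ofReal (1 / √(w + v).det) ∂μ ∂μ := by
    rw [← lintegral_const_mul' _ _ ENNReal.ofReal_ne_top]
    have h3 : ∀ v, ENNReal.ofReal (1 / √((2 * Real.pi) ^ n)) *
        ∫⁻ w, ENNReal.ofReal (1 / √(w + v).det) ∂μ =
        ∫⁻ w, ENNReal.ofReal (1 / √((2 * Real.pi) ^ n * (w + v).det)) ∂μ := by
      intro v
      rw [← lintegral_const_mul' _ _ ENNReal.ofReal_ne_top]
      refine lintegral_congr fun w => ?_
      rw [one_div_sqrt_two_pi_pow_mul, ENNReal.ofReal_mul (by positivity)]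
    rw [lintegral_congr h3, ← lintegral_mixtureDensity_sq hμ]
    refine lintegral_congr_ae ?_
    filter_upwards [hf, hf0] with x hx h0
    rw [← hx, Real.enorm_of_nonneg h0, ENNReal.rpow_two, sq]
  rw [h1, MemLp, and_iff_right hfm.aestronglyMeasurable,
    eLpNorm_lt_top_iff_lintegral_rpow_enorm_lt_top two_ne_zero ENNReal.ofNat_ne_top]
  have hc : 0 < 1 / √((2 * Real.pi) ^ n) := by positivity
  rw [ENNReal.toReal_ofNat, h2]
  constructor
  · intro h
    exact ENNReal.lt_top_of_mul_ne_top_right h.ne (ENNReal.ofReal_pos.2 hc).ne'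
  · exact fun h => ENNReal.mul_lt_top ENNReal.ofReal_lt_top h

end Mixture

/-! ### Existence of a minimizer. -/

section Minimization

open Filter Topology

variable {n : ℕ} {μ : Measure (Matrix (Fin n) (Fin n) ℝ)} {v t : Matrix (Fin n) (Fin n) ℝ}

/-- The mean of `1 / √det (V + t)` for `V` with distribution `μ`. -/
noncomputable def meanInvSqrtDet (μ : Measure (Matrix (Fin n) (Fin n) ℝ))
    (t : Matrix (Fin n) (Fin n) ℝ) : ℝ :=
  ∫ v, 1 / √(v + t).det ∂μ

/-- Up to an additive and a positive multiplicative constant, the squared `L²` distance between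
the mixture density and the density of `N(0, t)`. -/
noncomputable def distFunctional (μ : Measure (Matrix (Fin n) (Fin n) ℝ))
    (t : Matrix (Fin n) (Fin n) ℝ) : ℝ :=
  1 / √(t + t).det - 2 * meanInvSqrtDet μ t

lemma measurable_one_div_sqrt_det_add (t : Matrix (Fin n) (Fin n) ℝ) :
    Measurable fun v : Matrix (Fin n) (Fin n) ℝ => 1 / √(v + t).det := by
  have : Measurable fun v : Matrix (Fin n) (Fin n) ℝ => (v + t).det :=
    (by fun_prop : Continuous _).measurable
  fun_prop

lemma one_div_sqrt_det_add_le (ht : t.PosDef) (hv : v.PosSemidef) :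
    1 / √(v + t).det ≤ 1 / √t.det :=
  one_div_le_one_div_of_le (Real.sqrt_pos.2 ht.det_pos) (Real.sqrt_le_sqrt (ht.det_le_det_add hv))

lemma integrable_one_div_sqrt_det_add [IsFiniteMeasure μ] (hμ : ∀ᵐ v ∂μ, v.PosDef)
    (ht : t.PosDef) : Integrable (fun v => 1 / √(v + t).det) μ := by
  refine Integrable.of_bound (measurable_one_div_sqrt_det_add t).aestronglyMeasurable
    (1 / √t.det) ?_
  filter_upwards [hμ] with v hv
  rw [Real.norm_of_nonneg (by positivity)]
  exact one_div_sqrt_det_add_le ht hv.posSemidef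

lemma det_add_self (t : Matrix (Fin n) (Fin n) ℝ) : (t + t).det = 2 ^ n * t.det := by
  rw [← two_smul ℝ t, det_smul, Fintype.card_fin]

lemma lintegral_gaussianDensity_sq (ht : t.PosDef) :
    ∫⁻ x, ENNReal.ofReal (gaussianDensity t x ^ 2) =
      ENNReal.ofReal (1 / √((2 * Real.pi) ^ n) * (1 / √(t + t).det)) := by
  rw [← one_div_sqrt_two_pi_pow_mul, ← lintegral_gaussianDensity_mul ht ht]
  refine lintegral_congr fun x => ?_
  rw [sq, ENNReal.ofReal_mul (gaussianDensity_nonneg t x)]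

lemma memLp_gaussianDensity (ht : t.PosDef) : MemLp (gaussianDensity t) 2 volume := by
  rw [memLp_two_iff_integrable_sq (measurable_gaussianDensity t).aestronglyMeasurable]
  refine ⟨((measurable_gaussianDensity t).pow_const 2).aestronglyMeasurable, ?_⟩
  rw [hasFiniteIntegral_iff_ofReal (Eventually.of_forall fun x => by positivity),
    lintegral_gaussianDensity_sq ht]
  exact ENNReal.ofReal_lt_top

lemma integral_gaussianDensity_sq (ht : t.PosDef) :
    ∫ x, gaussianDensity t x ^ 2 = 1 / √((2 * Real.pi) ^ n) * (1 / √(t + t).det) := by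
  rw [integral_eq_lintegral_of_nonneg_ae (Eventually.of_forall fun x => by positivity)
    ((measurable_gaussianDensity t).pow_const 2).aestronglyMeasurable,
    lintegral_gaussianDensity_sq ht, ENNReal.toReal_ofReal (by positivity)]

lemma integral_mul_gaussianDensity [IsProbabilityMeasure μ] (hμ : ∀ᵐ v ∂μ, v.PosDef)
    {f : EuclideanSpace ℝ (Fin n) → ℝ} (hfm : AEMeasurable f) (hf0 : 0 ≤ᵐ[volume] f)
    (hf : (fun x => ENNReal.ofReal (f x)) =ᵐ[volume] mixtureDensity μ) (ht : t.PosDef) :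
    ∫ x, f x * gaussianDensity t x = 1 / √((2 * Real.pi) ^ n) * meanInvSqrtDet μ t := by
  have h1 : ∫⁻ x, ENNReal.ofReal (f x * gaussianDensity t x) =
      ∫⁻ v, ENNReal.ofReal (1 / √((2 * Real.pi) ^ n * (v + t).det)) ∂μ := by
    rw [← lintegral_mixtureDensity_mul_gaussianDensity hμ ht]
    refine lintegral_congr_ae ?_
    filter_upwards [hf, hf0] with x hx h0
    rw [ENNReal.ofReal_mul h0, hx]
  rw [integral_eq_lintegral_of_nonneg_ae _
    (by exact (hfm.mul (measurable_gaussianDensity t).aemeasurable).aestronglyMeasurable), h1,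
    meanInvSqrtDet, ← integral_const_mul]
  · simp only [← one_div_sqrt_two_pi_pow_mul]
    rw [integral_eq_lintegral_of_nonneg_ae (Eventually.of_forall fun x => by positivity)]
    simp only [one_div_sqrt_two_pi_pow_mul]
    exact ((measurable_one_div_sqrt_det_add t).const_mul _).aestronglyMeasurable
  · filter_upwards [hf0] with x h0
    exact mul_nonneg h0 (gaussianDensity_nonneg t x)

lemma sqL2Dist_eq [IsProbabilityMeasure μ] (hμ : ∀ᵐ v ∂μ, v.PosDef)
    {f : EuclideanSpace ℝ (Fin n) → ℝ} (hf0 : 0 ≤ᵐ[volume] f)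
    (hf : (fun x => ENNReal.ofReal (f x)) =ᵐ[volume] mixtureDensity μ) (hf2 : MemLp f 2 volume)
    (ht : t.PosDef) :
    sqL2Dist f t = (∫ x, f x ^ 2) + 1 / √((2 * Real.pi) ^ n) * distFunctional μ t := by
  have hg := memLp_gaussianDensity ht
  have hfg : Integrable fun x => f x * gaussianDensity t x := hf2.integrable_mul hg
  have h : ∀ x, (f x - gaussianDensity t x) ^ 2 =
      f x ^ 2 + (gaussianDensity t x ^ 2 - 2 * (f x * gaussianDensity t x)) := fun x => by ring
  rw [sqL2Dist, integral_congr_ae (Eventually.of_forall h), integral_add hf2.integrable_sq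
    (by exact hg.integrable_sq.sub (hfg.const_mul 2)), integral_sub hg.integrable_sq (hfg.const_mul 2),
    integral_const_mul, integral_gaussianDensity_sq ht,
    integral_mul_gaussianDensity hμ hf2.aestronglyMeasurable.aemeasurable hf0 hf ht,
    distFunctional]
  ring

/-- If `N(0, t)` is at least as close to `f` as the zero function, then `det t` cannot be small. -/
lemma one_div_sqrt_det_le_of_distFunctional_nonpos [IsProbabilityMeasure μ]
    (hμ : ∀ᵐ v ∂μ, v.PosDef)
    {f : EuclideanSpace ℝ (Fin n) → ℝ} (hf0 : 0 ≤ᵐ[volume] f)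
    (hf : (fun x => ENNReal.ofReal (f x)) =ᵐ[volume] mixtureDensity μ) (hf2 : MemLp f 2 volume)
    (ht : t.PosDef) (h : distFunctional μ t ≤ 0) :
    1 / √((2 * Real.pi) ^ n) * (1 / √(t + t).det) ≤ 4 * ∫ x, f x ^ 2 := by
  have hg := memLp_gaussianDensity ht
  have hfg : Integrable fun x => f x * gaussianDensity t x := hf2.integrable_mul hg
  have h1 : ∫ x, 2 * (f x * gaussianDensity t x) ≤
      ∫ x, (2 * f x ^ 2 + 1 / 2 * gaussianDensity t x ^ 2) := by
    refine integral_mono (hfg.const_mul 2) ((hf2.integrable_sq.const_mul 2).add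
      (hg.integrable_sq.const_mul (1 / 2))) fun x => ?_
    -- The weights leave only half of ‖g_t‖² on the right, to be absorbed by ‖g_t‖² ≤ 2⟨f, g_t⟩.
    nlinarith [sq_nonneg (2 * f x - gaussianDensity t x)]
  rw [integral_add (hf2.integrable_sq.const_mul 2) (hg.integrable_sq.const_mul (1 / 2)),
    integral_const_mul, integral_const_mul, integral_const_mul, integral_gaussianDensity_sq ht,
    integral_mul_gaussianDensity hμ hf2.aestronglyMeasurable.aemeasurable hf0 hf ht] at h1
  have h2 : 1 / √((2 * Real.pi) ^ n) * distFunctional μ t ≤ 0 :=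
    mul_nonpos_of_nonneg_of_nonpos (by positivity) h
  rw [distFunctional, mul_sub] at h2
  linarith

/-- Take t = r·1 with r large: r^(n/2) E det(V + r·1)^(-1/2) = E det(V/r + 1)^(-1/2) tends to 1, so
it exceeds 1/2, while det(2t)^(-1/2) ≤ r^(-n/2). -/
lemma exists_distFunctional_neg [IsProbabilityMeasure μ] (hμ : ∀ᵐ v ∂μ, v.PosDef) :
    ∃ t : Matrix (Fin n) (Fin n) ℝ, t.PosDef ∧ distFunctional μ t < 0 := by
  have hlim : Tendsto (fun k : ℕ => ∫ v, 1 / √((1 / ((k : ℝ) + 1)) • v + 1).det ∂μ) atTop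
      (𝓝 (∫ _v, (1 : ℝ) ∂μ)) := by
    refine tendsto_integral_of_dominated_convergence (fun _ => 1) (fun k => ?_)
      (integrable_const _) (fun k => ?_) ?_
    · have : Measurable fun v : Matrix (Fin n) (Fin n) ℝ => ((1 / ((k : ℝ) + 1)) • v + 1).det :=
        (by fun_prop : Continuous _).measurable
      exact (by fun_prop : Measurable _).aestronglyMeasurable
    · filter_upwards [hμ] with v hv
      rw [Real.norm_of_nonneg (by positivity)]
      have := one_div_sqrt_det_add_le (t := 1) PosDef.one
        (hv.posSemidef.smul (show (0 : ℝ) ≤ 1 / ((k : ℝ) + 1) by positivity))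
      simpa using this
    · refine Eventually.of_forall fun v => ?_
      have hc : ContinuousAt (fun s : ℝ => 1 / √(s • v + 1).det) 0 := by
        refine ContinuousAt.div continuousAt_const ?_ (by simp)
        exact (by fun_prop : Continuous fun s : ℝ => √(s • v + 1).det).continuousAt
      have := hc.tendsto.comp (tendsto_one_div_add_atTop_nhds_zero_nat (𝕜 := ℝ))
      simpa [Function.comp_def] using this
  rw [integral_const, probReal_univ, one_smul] at hlim
  obtain ⟨k, hk⟩ := (hlim.eventually_const_lt (show (1 / 2 : ℝ) < 1 by norm_num)).exists
  have hr : (0 : ℝ) < (k : ℝ) + 1 := by positivity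
  set r : ℝ := (k : ℝ) + 1
  have hD : (0 : ℝ) < √(r ^ n) := by positivity
  refine ⟨r • 1, PosDef.one.smul hr, ?_⟩
  have h1 : meanInvSqrtDet μ (r • 1) = 1 / √(r ^ n) * ∫ v, 1 / √((1 / r) • v + 1).det ∂μ := by
    rw [meanInvSqrtDet, ← integral_const_mul]
    congr 1 with v
    have : v + r • 1 = r • ((1 / r) • v + 1) := by
      rw [smul_add, smul_smul, mul_one_div_cancel hr.ne', one_smul]
    rw [this, det_smul, Fintype.card_fin, Real.sqrt_mul (by positivity), div_mul_div_comm, mul_one]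
  have h2 : 1 / √(r • (1 : Matrix (Fin n) (Fin n) ℝ) + r • 1).det ≤ 1 / √(r ^ n) := by
    have := one_div_sqrt_det_add_le (PosDef.one.smul hr)
      (PosDef.one (n := Fin n) (R := ℝ).smul hr).posSemidef
    simpa [det_smul] using this
  have h3 : 1 / √(r ^ n) * (1 / 2) < 1 / √(r ^ n) * ∫ v, 1 / √((1 / r) • v + 1).det ∂μ :=
    mul_lt_mul_of_pos_left hk (by positivity)
  rw [distFunctional, h1]
  linarith

/-- For fixed v, det (v + T k) grows at least linearly in the trace of T k; the floor on det (T k)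
supplies the dominating constant. -/
lemma tendsto_meanInvSqrtDet_zero [IsProbabilityMeasure μ] (hμ : ∀ᵐ v ∂μ, v.PosDef) {a : ℝ}
    (ha : 0 < a) {T : ℕ → Matrix (Fin n) (Fin n) ℝ} (hT : ∀ k, (T k).PosDef)
    (hdet : ∀ k, a ≤ (T k).det) (htr : Tendsto (fun k => (T k).trace) atTop atTop) :
    Tendsto (fun k => meanInvSqrtDet μ (T k)) atTop (𝓝 0) := by
  rw [← integral_zero (Matrix (Fin n) (Fin n) ℝ) ℝ (μ := μ)]
  refine tendsto_integral_of_dominated_convergence (fun _ => 1 / √a) (fun k =>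
    (measurable_one_div_sqrt_det_add _).aestronglyMeasurable)
      (integrable_const _) (fun k => ?_) ?_
  · filter_upwards [hμ] with v hv
    rw [Real.norm_of_nonneg (by positivity)]
    exact (one_div_sqrt_det_add_le (hT k) hv.posSemidef).trans
      (one_div_le_one_div_of_le (Real.sqrt_pos.2 ha) (Real.sqrt_le_sqrt (hdet k)))
  · filter_upwards [hμ] with v hv
    have hC : 0 ≤ n ^ 2 * v.trace := mul_nonneg (by positivity) hv.posSemidef.trace_nonneg
    -- The `+ 1` keeps the denominator positive, even for n = 0.
    have h1 : ∀ k, v.det * ((T k).trace / (n ^ 2 * v.trace + 1)) ≤ (v + T k).det := by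
      intro k
      have h0 := hv.trace_inv_mul_nonneg (hT k).posSemidef
      have h2 := hv.trace_le_trace_inv_mul (hT k).posSemidef
      have h3 := hv.det_mul_one_add_trace_le (hT k).posSemidef
      rw [add_comm (T k)] at h3
      refine le_trans (mul_le_mul_of_nonneg_left ?_ hv.det_pos.le) h3
      rw [div_le_iff₀ (by positivity)]
      nlinarith [mul_nonneg hC h0]
    have h2 : Tendsto (fun k => (v + T k).det) atTop atTop :=
      tendsto_atTop_mono h1 ((htr.atTop_div_const (by positivity)).const_mul_atTop hv.det_pos)
    simpa [Function.comp_def] using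
      (tendsto_inv_atTop_zero.comp (Real.tendsto_sqrt_atTop.comp h2))

/-- J(t) ≤ b forces the mean to be at least -b/2 > 0, which unbounded traces would contradict. -/
lemma exists_trace_le_of_distFunctional_le [IsProbabilityMeasure μ] (hμ : ∀ᵐ v ∂μ, v.PosDef)
    {a b : ℝ} (ha : 0 < a) (hb : b < 0) :
    ∃ R : ℝ, ∀ t : Matrix (Fin n) (Fin n) ℝ, t.PosDef → a ≤ t.det → distFunctional μ t ≤ b →
      t.trace ≤ R := by
  by_contra! h
  choose T hT hdet hle htr using fun k : ℕ => h k
  have hlim := tendsto_meanInvSqrtDet_zero hμ ha hT hdet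
    (tendsto_atTop_mono (fun k => (htr k).le) tendsto_natCast_atTop_atTop)
  obtain ⟨k, hk⟩ := (hlim.eventually_lt_const (show 0 < -b / 2 by linarith)).exists
  have h1 := hle k
  have h2 : 0 ≤ 1 / √(T k + T k).det := by positivity
  rw [distFunctional] at h1
  linarith

lemma continuousOn_distFunctional [IsProbabilityMeasure μ] (hμ : ∀ᵐ v ∂μ, v.PosDef) {a : ℝ}
    (ha : 0 < a) : ContinuousOn (distFunctional μ) {t | t.PosDef ∧ a ≤ t.det} := by
  have hc : ∀ v : Matrix (Fin n) (Fin n) ℝ, ContinuousOn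
      (fun t : Matrix (Fin n) (Fin n) ℝ => 1 / √(v + t).det) {t | 0 < (v + t).det} := by
    intro v
    refine ContinuousOn.div continuousOn_const ?_ fun t ht => (Real.sqrt_pos.2 ht).ne'
    exact (by fun_prop : Continuous fun t : Matrix (Fin n) (Fin n) ℝ => √(v + t).det).continuousOn
  refine ContinuousOn.sub ?_ (ContinuousOn.mul continuousOn_const ?_)
  · refine ContinuousOn.div continuousOn_const ?_
      fun t ht => (Real.sqrt_pos.2 (ht.1.add ht.1).det_pos).ne'
    exact (by fun_prop : Continuous fun t : Matrix (Fin n) (Fin n) ℝ => √(t + t).det).continuousOn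
  · refine continuousOn_of_dominated (bound := fun _ => 1 / √a)
      (fun t _ => (measurable_one_div_sqrt_det_add t).aestronglyMeasurable) (fun t ht => ?_)
      (integrable_const _) ?_
    · filter_upwards [hμ] with v hv
      rw [Real.norm_of_nonneg (by positivity)]
      exact (one_div_sqrt_det_add_le ht.1 hv.posSemidef).trans
        (one_div_le_one_div_of_le (Real.sqrt_pos.2 ha) (Real.sqrt_le_sqrt ht.2))
    · filter_upwards [hμ] with v hv
      exact (hc v).mono fun t ht => (hv.add ht.1).det_pos

lemma exists_isMinOn_distFunctional [IsProbabilityMeasure μ] (hμ : ∀ᵐ v ∂μ, v.PosDef)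
    {f : EuclideanSpace ℝ (Fin n) → ℝ} (hf0 : 0 ≤ᵐ[volume] f)
    (hf : (fun x => ENNReal.ofReal (f x)) =ᵐ[volume] mixtureDensity μ) (hf2 : MemLp f 2 volume) :
    ∃ t₀ ∈ posDefCone n, IsMinOn (distFunctional μ) (posDefCone n) t₀ := by
  obtain ⟨t₁, ht₁, hneg⟩ := exists_distFunctional_neg hμ
  have hM : 0 ≤ ∫ x, f x ^ 2 := integral_nonneg fun x => by positivity
  set c : ℝ := 1 / √((2 * Real.pi) ^ n) with hc
  have hc0 : 0 < c := by positivity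
  -- A lower bound for √det(2t) where J ≤ 0; as det(2t) = 2^n det t, it gives the floor b²/2^n for
  -- det t.
  set b : ℝ := c / (4 * (∫ x, f x ^ 2) + 1) with hb
  have hb0 : 0 < b := by positivity
  have ha : 0 < b ^ 2 / 2 ^ n := by positivity
  have hdet : ∀ t : Matrix (Fin n) (Fin n) ℝ, t.PosDef → distFunctional μ t ≤ 0 →
      b ^ 2 / 2 ^ n ≤ t.det := by
    intro t ht h
    have h1 := one_div_sqrt_det_le_of_distFunctional_nonpos hμ hf0 hf hf2 ht h
    have hs : 0 < √(t + t).det := Real.sqrt_pos.2 (ht.add ht).det_pos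
    rw [← hc, mul_one_div, div_le_iff₀ hs] at h1
    have h2 : b ≤ √(t + t).det := by
      rw [hb, div_le_iff₀ (by positivity)]
      nlinarith
    rw [Real.le_sqrt hb0.le (ht.add ht).det_pos.le, det_add_self] at h2
    rw [div_le_iff₀ (by positivity)]
    linarith
  obtain ⟨R, hR⟩ := exists_trace_le_of_distFunctional_le hμ ha hneg
  obtain ⟨t₀, ht₀, hmin⟩ := (isCompact_posDef_le_det_trace_le (R := R) ha).exists_isMinOn
    ⟨t₁, ht₁, hdet t₁ ht₁ hneg.le, hR t₁ ht₁ (hdet t₁ ht₁ hneg.le) le_rfl⟩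
    ((continuousOn_distFunctional hμ ha).mono fun t ht => ⟨ht.1, ht.2.1⟩)
  refine ⟨t₀, ht₀.1, fun t ht => ?_⟩
  -- Either t does at least as well as t₁ and so lies in the compact set, or t₁, which lies there,
  -- beats it.
  rcases le_total (distFunctional μ t) (distFunctional μ t₁) with h | h
  · have hd := hdet t ht (h.trans hneg.le)
    exact hmin ⟨ht, hd, hR t ht hd h⟩
  · have hd := hdet t₁ ht₁ hneg.le
    exact le_trans (hmin ⟨ht₁, hd, hR t₁ ht₁ hd le_rfl⟩) h

end Minimization

/-! ### The equation satisfied by a minimizer. -/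

section Stationarity

open Filter Topology

variable {n : ℕ} {μ : Measure (Matrix (Fin n) (Fin n) ℝ)} {v t : Matrix (Fin n) (Fin n) ℝ}

/-- Keeps a segment on both sides of t inside the cone, so that a minimizer over the cone is a local
minimum in s. -/
lemma Matrix.PosDef.add_smul_vecMulVec (ht : t.PosDef) (x : Fin n → ℝ) {s : ℝ}
    (hs : |s| * (x ⬝ᵥ t⁻¹ *ᵥ x) ≤ 1 / 2) : (t + s • vecMulVec x x).PosDef := by
  have hH : (t + s • vecMulVec x x).IsHermitian := by
    refine ht.1.add ?_
    ext i j
    simp [vecMulVec_apply, mul_comm]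
  refine PosDef.of_dotProduct_mulVec_pos hH fun y hy => ?_
  have hty := ht.dotProduct_mulVec_pos hy
  set z := t⁻¹ *ᵥ x with hz
  have hz' : t *ᵥ z = x := by
    rw [hz, mulVec_mulVec, mul_nonsing_inv _ ht.det_pos.ne'.isUnit, one_mulVec]
  set q := x ⬝ᵥ z
  have hzy : z ⬝ᵥ t *ᵥ y = x ⬝ᵥ y := by
    rw [dotProduct_mulVec, ← mulVec_transpose, ← conjTranspose_eq_transpose_of_trivial, ht.1.eq,
      hz']
  simp only [star_trivial] at hty ⊢
  have key : ∀ r : ℝ, 0 ≤ y ⬝ᵥ t *ᵥ y - 2 * r * (x ⬝ᵥ y) + r ^ 2 * q := by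
    intro r
    have h1 := ht.posSemidef.dotProduct_mulVec_nonneg (y - r • z)
    simp only [star_trivial, mulVec_sub, mulVec_smul, dotProduct_sub, sub_dotProduct, hz',
      smul_dotProduct, dotProduct_smul, smul_eq_mul, hzy, dotProduct_comm y x,
      dotProduct_comm z x] at h1
    linarith
  have hexp : y ⬝ᵥ (t + s • vecMulVec x x) *ᵥ y = y ⬝ᵥ t *ᵥ y + s * (x ⬝ᵥ y) ^ 2 := by
    rw [add_mulVec, dotProduct_add, smul_mulVec, dotProduct_smul, vecMulVec_mulVec]
    simp [dotProduct_comm y x]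
    left
    ring
  rw [hexp]
  -- This r gives y*ty ≥ 2|s|(x·y)², twice what the perturbation can remove.
  have h2 := key (2 * |s| * (x ⬝ᵥ y))
  have h3 : -(|s| * (x ⬝ᵥ y) ^ 2) ≤ s * (x ⬝ᵥ y) ^ 2 := by
    rw [← neg_mul]
    exact mul_le_mul_of_nonneg_right (neg_abs_le s) (sq_nonneg _)
  have h4 : |s| * (x ⬝ᵥ y) ^ 2 * (|s| * q) ≤ |s| * (x ⬝ᵥ y) ^ 2 * (1 / 2) :=
    mul_le_mul_of_nonneg_left hs (by positivity)
  rcases eq_or_ne (|s| * (x ⬝ᵥ y) ^ 2) 0 with h0 | h0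
  · linarith
  · have h5 : 0 < |s| * (x ⬝ᵥ y) ^ 2 := lt_of_le_of_ne (by positivity) h0.symm
    nlinarith

lemma hasDerivAt_one_div_sqrt_one_add_mul (q : ℝ) {s : ℝ} (h : 0 < 1 + s * q) :
    HasDerivAt (fun s : ℝ => 1 / √(1 + s * q)) (-(q / 2) / (√(1 + s * q) * (1 + s * q))) s := by
  have h1 : HasDerivAt (fun s : ℝ => 1 + s * q) q s := by
    simpa using ((hasDerivAt_id s).mul_const q).const_add 1
  have h2 := (h1.sqrt h.ne').inv (Real.sqrt_pos.2 h).ne'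
  simp only [one_div]
  refine h2.congr_deriv ?_
  rw [Real.sq_sqrt h.le]
  have := Real.sqrt_pos.2 h
  field_simp

lemma quadForm_inv_add_nonneg (ht : t.PosDef) (hv : v.PosDef) (x : Fin n → ℝ) :
    0 ≤ x ⬝ᵥ (v + t)⁻¹ *ᵥ x := by
  simpa using (hv.add ht).inv.posSemidef.dotProduct_mulVec_nonneg x

lemma measurable_inv_add_apply (t : Matrix (Fin n) (Fin n) ℝ) (i j : Fin n) :
    Measurable fun v : Matrix (Fin n) (Fin n) ℝ => (v + t)⁻¹ i j :=
  (measurable_matrix_inv_apply i j).comp (by fun_prop : Continuous _).measurable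

lemma measurable_quadForm_inv_add (t : Matrix (Fin n) (Fin n) ℝ) (x : Fin n → ℝ) :
    Measurable fun v : Matrix (Fin n) (Fin n) ℝ => x ⬝ᵥ (v + t)⁻¹ *ᵥ x :=
  Finset.measurable_fun_sum _ fun i _ => by
    refine Measurable.const_mul ?_ (x i)
    simp only [mulVec, dotProduct]
    exact Finset.measurable_fun_sum _ fun j _ =>
      (measurable_inv_add_apply t i j).mul_const (x j)

/-- The determinant lemma isolates s in the factor (1 + s q_v)^(-1/2), q_v = x*(v+t)⁻¹x. Since 0 ≤
q_v ≤ q₀ = x*t⁻¹x for positive definite v, one interval and one constant dominate the derivative for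
almost every v. -/
lemma hasDerivAt_meanInvSqrtDet [IsProbabilityMeasure μ] (hμ : ∀ᵐ v ∂μ, v.PosDef)
    (ht : t.PosDef) (x : Fin n → ℝ) :
    HasDerivAt (fun s : ℝ => meanInvSqrtDet μ (t + s • vecMulVec x x))
      (∫ v, 1 / √(v + t).det * (-(x ⬝ᵥ (v + t)⁻¹ *ᵥ x / 2)) ∂μ) 0 := by
  set q₀ := x ⬝ᵥ t⁻¹ *ᵥ x
  have hq₀ : 0 ≤ q₀ := by simpa using ht.inv.posSemidef.dotProduct_mulVec_nonneg x
  -- On this radius |s| q₀ ≤ 1/2; the `+ 1` covers q₀ = 0.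
  have hδ : 0 < 1 / (2 * (q₀ + 1)) := by positivity
  have hdet : ∀ v : Matrix (Fin n) (Fin n) ℝ, v.PosDef → ∀ s : ℝ,
      1 / √(v + (t + s • vecMulVec x x)).det =
        1 / √(v + t).det * (1 / √(1 + s * (x ⬝ᵥ (v + t)⁻¹ *ᵥ x))) := by
    intro v hv s
    rw [← add_assoc, det_add_smul_vecMulVec (hv.add ht).det_pos.ne',
      Real.sqrt_mul (hv.add ht).det_pos.le, div_mul_div_comm, mul_one]
  have hball : ∀ v : Matrix (Fin n) (Fin n) ℝ, v.PosDef →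
      ∀ s ∈ Metric.ball (0 : ℝ) (1 / (2 * (q₀ + 1))),
        1 / 2 ≤ 1 + s * (x ⬝ᵥ (v + t)⁻¹ *ᵥ x) := by
    intro v hv s hs
    rw [mem_ball_zero_iff, Real.norm_eq_abs, lt_div_iff₀ (by positivity)] at hs
    have h1 := quadForm_inv_add_nonneg ht hv x
    have h2 := ht.dotProduct_inv_add_mulVec_le hv.posSemidef x
    have h3 : |s * (x ⬝ᵥ (v + t)⁻¹ *ᵥ x)| ≤ |s| * q₀ := by
      rw [abs_mul, abs_of_nonneg h1]
      exact mul_le_mul_of_nonneg_left h2 (abs_nonneg s)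
    have h4 := (abs_le.1 h3).1
    nlinarith [abs_nonneg s]
  have hmain := (hasDerivAt_integral_of_dominated_loc_of_deriv_le (μ := μ)
    (F := fun s v => 1 / √(v + t).det * (1 / √(1 + s * (x ⬝ᵥ (v + t)⁻¹ *ᵥ x))))
    (F' := fun s v => 1 / √(v + t).det * (-(x ⬝ᵥ (v + t)⁻¹ *ᵥ x / 2) /
      (√(1 + s * (x ⬝ᵥ (v + t)⁻¹ *ᵥ x)) * (1 + s * (x ⬝ᵥ (v + t)⁻¹ *ᵥ x)))))
    (bound := fun _ => 1 / √t.det * (q₀ / 2 / (√(1 / 2) * (1 / 2)))) (x₀ := (0 : ℝ))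
    (Metric.ball_mem_nhds 0 hδ) ?_ ?_ ?_ ?_ (integrable_const _) ?_).2
  · have h0 : (fun s : ℝ => meanInvSqrtDet μ (t + s • vecMulVec x x)) = fun s =>
        ∫ v, 1 / √(v + t).det * (1 / √(1 + s * (x ⬝ᵥ (v + t)⁻¹ *ᵥ x))) ∂μ := by
      ext s
      refine integral_congr_ae ?_
      filter_upwards [hμ] with v hv
      exact hdet v hv s
    rw [h0]
    simpa using hmain
  · refine Eventually.of_forall fun s => ?_
    have h1 := measurable_one_div_sqrt_det_add t
    have h2 := measurable_quadForm_inv_add t x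
    exact (h1.mul (by fun_prop)).aestronglyMeasurable
  · simpa using integrable_one_div_sqrt_det_add hμ ht
  · have h1 := measurable_one_div_sqrt_det_add t
    have h2 := measurable_quadForm_inv_add t x
    exact (h1.mul (by fun_prop)).aestronglyMeasurable
  · filter_upwards [hμ] with v hv s hs
    have h1 := quadForm_inv_add_nonneg ht hv x
    have h2 := ht.dotProduct_inv_add_mulVec_le hv.posSemidef x
    have h3 := hball v hv s hs
    have h4 : 0 < 1 + s * (x ⬝ᵥ (v + t)⁻¹ *ᵥ x) := by linarith
    rw [norm_mul, neg_div, norm_neg, Real.norm_of_nonneg (by positivity : 0 ≤ 1 / √(v + t).det),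
      Real.norm_of_nonneg (by positivity)]
    have h5 := Real.sqrt_le_sqrt h3
    have h6 := one_div_sqrt_det_add_le ht hv.posSemidef
    gcongr
  · filter_upwards [hμ] with v hv s hs
    have h3 := hball v hv s hs
    exact (hasDerivAt_one_div_sqrt_one_add_mul _ (by linarith)).const_mul _

lemma integral_quadForm_eq_of_isMinOn [IsProbabilityMeasure μ] (hμ : ∀ᵐ v ∂μ, v.PosDef)
    (ht : t.PosDef) (hmin : IsMinOn (distFunctional μ) (posDefCone n) t) (x : Fin n → ℝ) :
    ∫ v, 1 / √(v + t).det * (x ⬝ᵥ (v + t)⁻¹ *ᵥ x) ∂μ =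
      1 / 2 * (1 / √(2 ^ n * t.det)) * (x ⬝ᵥ t⁻¹ *ᵥ x) := by
  set q₀ := x ⬝ᵥ t⁻¹ *ᵥ x with hq
  have hq₀ : 0 ≤ q₀ := by simpa using ht.inv.posSemidef.dotProduct_mulVec_nonneg x
  have h1 : HasDerivAt (fun s : ℝ => 1 / √((t + s • vecMulVec x x) + (t + s • vecMulVec x x)).det)
      (1 / √(2 ^ n * t.det) * (-(q₀ / 2))) 0 := by
    have h := (hasDerivAt_one_div_sqrt_one_add_mul q₀ (s := 0) (by simp)).const_mul
      (1 / √(2 ^ n * t.det))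
    simp only [zero_mul, add_zero, Real.sqrt_one, mul_one, div_one] at h
    refine h.congr_of_eventuallyEq (Eventually.of_forall fun s => ?_)
    have := ht.det_pos
    simp only
    rw [det_add_self, det_add_smul_vecMulVec ht.det_pos.ne', ← mul_assoc,
      Real.sqrt_mul (by positivity), div_mul_div_comm, mul_one]
  have h2 := h1.sub ((hasDerivAt_meanInvSqrtDet hμ ht x).const_mul 2)
  have hloc : IsLocalMin (fun s : ℝ => distFunctional μ (t + s • vecMulVec x x)) 0 := by
    filter_upwards [Metric.ball_mem_nhds (0 : ℝ) (show 0 < 1 / (2 * (q₀ + 1)) by positivity)]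
      with s hs
    rw [mem_ball_zero_iff, Real.norm_eq_abs, lt_div_iff₀ (by positivity)] at hs
    have h : (t + s • vecMulVec x x).PosDef :=
      ht.add_smul_vecMulVec x (by rw [← hq]; nlinarith [abs_nonneg s])
    simpa using hmin h
  have h3 := hloc.hasDerivAt_eq_zero h2
  have h4 : ∫ v, 1 / √(v + t).det * (-(x ⬝ᵥ (v + t)⁻¹ *ᵥ x / 2)) ∂μ =
      -(1 / 2) * ∫ v, 1 / √(v + t).det * (x ⬝ᵥ (v + t)⁻¹ *ᵥ x) ∂μ := by
    rw [← integral_const_mul]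
    congr 1 with v
    ring
  rw [h4] at h3
  linarith

lemma integrable_resolventKernel [IsProbabilityMeasure μ] (hμ : ∀ᵐ v ∂μ, v.PosDef)
    (ht : t.PosDef) (i j : Fin n) : Integrable (fun v => resolventKernel t v i j) μ := by
  refine Integrable.of_bound ((measurable_one_div_sqrt_det_add t).mul
    (measurable_inv_add_apply t i j)).aestronglyMeasurable
    (1 / √t.det * t⁻¹.trace) ?_
  filter_upwards [hμ] with v hv
  have h1 := (hv.add ht).inv.posSemidef.abs_apply_le_trace i j
  have h2 := ht.trace_inv_add_le hv.posSemidef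
  rw [resolventKernel, Matrix.smul_apply, smul_eq_mul, norm_mul,
    Real.norm_of_nonneg (by positivity), Real.norm_eq_abs]
  exact mul_le_mul (one_div_sqrt_det_add_le ht hv.posSemidef) (h1.trans h2) (abs_nonneg _)
    (by positivity)

lemma two_rpow_one_add_half (n : ℕ) : (2 : ℝ) ^ (1 + (n : ℝ) / 2) = 2 * √(2 ^ n) := by
  rw [Real.rpow_add two_pos, Real.rpow_one, Real.sqrt_eq_rpow, ← Real.rpow_natCast,
    ← Real.rpow_mul two_pos.le, mul_one_div]

/-- Both sides are symmetric, so comparing quadratic forms suffices. -/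
lemma integral_resolventKernel_of_isMinOn [IsProbabilityMeasure μ] (hμ : ∀ᵐ v ∂μ, v.PosDef)
    (ht : t.PosDef) (hmin : IsMinOn (distFunctional μ) (posDefCone n) t) :
    (Matrix.of fun i j => ∫ v, resolventKernel t v i j ∂μ) =
      (1 / (2 : ℝ) ^ (1 + (n : ℝ) / 2)) • ((1 / √t.det) • t⁻¹) := by
  have hint := integrable_resolventKernel hμ ht
  refine eq_of_dotProduct_mulVec_eq ?_ ?_ fun x => ?_
  · ext i j
    simp only [conjTranspose_apply, of_apply, star_trivial]
    refine integral_congr_ae ?_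
    filter_upwards [hμ] with v hv
    have := (hv.add ht).inv.1.apply i j
    rw [star_trivial] at this
    simp [resolventKernel, this]
  · ext i j
    have := ht.inv.1.apply i j
    rw [star_trivial] at this
    simp [this]
  · have h1 : x ⬝ᵥ (Matrix.of fun i j => ∫ v, resolventKernel t v i j ∂μ) *ᵥ x =
        ∫ v, 1 / √(v + t).det * (x ⬝ᵥ (v + t)⁻¹ *ᵥ x) ∂μ := by
      have h2 : ∀ v, 1 / √(v + t).det * (x ⬝ᵥ (v + t)⁻¹ *ᵥ x) =
          ∑ i, x i * ∑ j, resolventKernel t v i j * x j := by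
        intro v
        simp only [resolventKernel, dotProduct, mulVec, Finset.mul_sum, Matrix.smul_apply,
          smul_eq_mul]
        exact Finset.sum_congr rfl fun i _ => Finset.sum_congr rfl fun j _ => by ring
      simp only [h2]
      rw [integral_finsetSum _ fun i _ => (integrable_finsetSum _ fun j _ =>
        (hint i j).mul_const _).const_mul _]
      simp only [dotProduct, mulVec, of_apply, integral_const_mul]
      refine Finset.sum_congr rfl fun i _ => ?_
      rw [integral_finsetSum _ fun j _ => (hint i j).mul_const _]
      simp only [integral_mul_const]
    rw [h1, integral_quadForm_eq_of_isMinOn hμ ht hmin x, two_rpow_one_add_half,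
      Real.sqrt_mul (by positivity)]
    simp only [smul_mulVec, dotProduct_smul, smul_eq_mul]
    have := Real.sqrt_pos.2 ht.det_pos
    field_simp

end Stationarity

theorem proposition4p2 (n : ℕ)
    (μ : Measure (Matrix (Fin n) (Fin n) ℝ)) [IsProbabilityMeasure μ]
    (hμ : ∀ᵐ v ∂μ, v ∈ posDefCone n)
    {Ω : Type*} [MeasurableSpace Ω] (P : Measure Ω) [IsProbabilityMeasure P]
    (V : Ω → Matrix (Fin n) (Fin n) ℝ) (Z : Ω → EuclideanSpace ℝ (Fin n))
    (hV : HasLaw V μ P) (hZ : HasLaw Z (stdGaussian (EuclideanSpace ℝ (Fin n))) P)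
    (hVZ : IndepFun V Z P) :
    -- the density exists, and everything below holds for every version of it
    (∃ f : EuclideanSpace ℝ (Fin n) → ℝ, IsDensity P (scaleMixture V Z) f) ∧
    ∀ f : EuclideanSpace ℝ (Fin n) → ℝ, IsDensity P (scaleMixture V Z) f →
      -- part 1, for any independent pair `(U, U₁)` of matrices with distribution `μ`
      (∀ {Ω' : Type*} [MeasurableSpace Ω'] (P' : Measure Ω') [IsProbabilityMeasure P']
        (U U₁ : Ω' → Matrix (Fin n) (Fin n) ℝ),
        HasLaw U μ P' → HasLaw U₁ μ P' → IndepFun U U₁ P' →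
        (MemLp f 2 volume ↔
          ∫⁻ ω, ENNReal.ofReal (1 / (CFC.sqrt (U ω + U₁ ω)).det) ∂P' < ∞)) ∧
      -- part 2
      (MemLp f 2 volume →
        (∀ t ∈ posDefCone n, Integrable (fun x => (f x - gaussianDensity t x) ^ 2) volume) ∧
        (∃ t₀ ∈ posDefCone n, IsMinOn (sqL2Dist f) (posDefCone n) t₀) ∧
        ∀ t₀ ∈ posDefCone n, IsMinOn (sqL2Dist f) (posDefCone n) t₀ →
          (∀ i j, Integrable (fun v => resolventKernel t₀ v i j) μ) ∧
          (Matrix.of fun i j => ∫ v, resolventKernel t₀ v i j ∂μ) =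
            (1 / (2 : ℝ) ^ (1 + (n : ℝ) / 2)) • ((1 / √t₀.det) • t₀⁻¹)) := by
  have hpd : ∀ᵐ v ∂μ, v.PosDef := hμ
  refine ⟨⟨_, isDensity_mixtureDensity hpd hV hZ hVZ⟩, fun f hf => ?_⟩
  have hae := hf.ofReal_ae_eq hpd hV hZ hVZ
  refine ⟨fun P' _ U U₁ hU hU₁ hUU =>
    memLp_two_iff_lintegral_lt_top hpd hf.aemeasurable hf.nonneg hae hU hU₁ hUU, fun hf2 => ?_⟩
  have hc : 0 < 1 / √((2 * Real.pi) ^ n) := by positivity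
  -- I is an increasing affine function of J on the cone, hence has the same minimizers.
  have hiff : ∀ t₀ ∈ posDefCone n, IsMinOn (sqL2Dist f) (posDefCone n) t₀ ↔
      IsMinOn (distFunctional μ) (posDefCone n) t₀ := by
    intro t₀ ht₀
    simp only [isMinOn_iff]
    refine forall₂_congr fun t ht => ?_
    rw [sqL2Dist_eq hpd hf.nonneg hae hf2 ht, sqL2Dist_eq hpd hf.nonneg hae hf2 ht₀,
      add_le_add_iff_left, mul_le_mul_iff_right₀ hc]
  refine ⟨fun t ht => (hf2.sub (memLp_gaussianDensity ht)).integrable_sq, ?_, fun t₀ ht₀ hmin =>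
    ⟨integrable_resolventKernel hpd ht₀,
      integral_resolventKernel_of_isMinOn hpd ht₀ ((hiff t₀ ht₀).1 hmin)⟩⟩
  obtain ⟨t₀, ht₀, hmin⟩ := exists_isMinOn_distFunctional hpd hf.nonneg hae hf2
  exact ⟨t₀, ht₀, (hiff t₀ ht₀).2 hmin⟩
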